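/- All graphs are finite, simple and undirected. For a graph $G$, let $\lambda(G)$ denote the largest eigenvalue of its adjacency matrix, and for integers $r,k$ let $B_{r,k}=K_r\vee I_k$ be the generalized book obtained by joining every vertex of a clique $K_r$ to every vertex of an independent set $I_k$ of size $k$. "Contains" means as a not necessarily induced subgraph. **Theorem.** Let $r\ge 2$ be an integer. 1. There is a constant $c=c(r)>0$ such that every graph $G$ with $m$ edges and $$\lambda^2(G)>\Bigl(1-\frac1r\Bigr)2m$$ contains a copy of $B_{r,k}$ for some $k\ge c\sqrt m$. 2. The order $\sqrt m$ is best possible: there is a constant $C=C(r)>0$ such that for every sufficiently large $m$ there is a graph $G$ with $m$ edges and $\lambda^2(G)>\bigl(1-\frac1r\bigr)2m$ such that every generalized book $B_{r,k}$ contained in $G$ satisfies $k\le C\sqrt m$. 3. Consequently the Li–Liu–Feng conjecture holds: for every $k\ge 1$ and all sufficiently large $m$ (depending on $r$ and $k$), every $B_{r,k}$-free graph $G$ with $m$ edges satisfies $\lambda^2(G)\le\bigl(1-\frac1r\bigr)2m$. -/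

import Mathlib

open Filter

universe u

/-- The join `G ∨ H`: the disjoint union of `G` and `H`, together with all edges between them. -/
def SimpleGraph.joinGraph {V W : Type*} (G : SimpleGraph V) (H : SimpleGraph W) :
    SimpleGraph (V ⊕ W) :=
  (G ⊕g H) ⊔ completeBipartiteGraph V W

/-- The generalized book `B_{r,k} = K_r ∨ I_k`: the join of a clique on `r` vertices and an
independent set of `k` vertices. -/
def generalizedBook (r k : ℕ) : SimpleGraph (Fin r ⊕ Fin k) :=
  SimpleGraph.joinGraph (⊤ : SimpleGraph (Fin r)) (⊥ : SimpleGraph (Fin k))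

open Classical in
/-- The spectral radius `λ(G)` of a finite graph: the largest eigenvalue of its real adjacency
matrix. The spectrum is a finite set of reals, nonempty when `V` is nonempty;
the value is `0` when `V` is empty. -/
noncomputable def SimpleGraph.adjSpectralRadius {V : Type*} [Fintype V] (G : SimpleGraph V) : ℝ :=
  sSup (spectrum ℝ (G.adjMatrix ℝ))

/-!
Let `β = 2 (1 - 1/r)` and let `α = β (1 - ε)` with `ε = 1 / (24 r)`.

For the book of size `c √m`, suppose `λ(G)² > β m`, and pass to a subgraph `H` of `G` maximizing
`λ² - α m`. Maximality keeps `λ(H)² > β m(H)`, and it gives `λ(H)² ≥ ε m(G)` as well, so it is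
enough to find a book in `H` of size linear in `λ = λ(H)`. Let `x` be a nonnegative unit
eigenvector of `H` and let `y = x²`, a probability weight on the vertices. Deleting an edge `uv`, or
all the edges at a vertex `v`, cannot increase `λ² - α m`; this yields `4 λ x_u x_v ≥ α`
(`IsPerronVector.le_of_adj`) and `α d(v) (1 - y_v / 2) ≤ 2 λ² y_v` (`IsPerronVector.degree_le`).
By Cauchy–Schwarz, the neighbourhood of each vertex then has `y`-weight almost
`(1 - 1/r) (1 - y_v / 2)`, and this remains true after discarding any set `S` of vertices with
`|S|` small compared with `λ² y_v` (`IsPerronVector.le_weight_compl`).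

Cauchy–Schwarz over the edges shows that `y` has edge density above `1 - 1/r`, so by the weighted
Turán theorem `H` has a clique `K` with `r + 1` vertices. If all vertices of `K` have weight of
order at least `1 / λ`, discard the vertices heavier than a large multiple `b` of `1 / λ`. The
weights seen by the vertices of `K` add up to more than `r - 1` by a constant, so a constant weight
of vertices lighter than `b` is joined to `r` vertices of `K`. These are linearly many in `λ`, and
some `r` vertices of `K` are joined to a proportion `1 / (r + 1)` of them
(`exists_generalizedBook_of_weight`). If instead some `v ∈ K` is very light, the edge condition
makes all its neighbours heavy. The heavy vertices then carry a definite share of the total weight,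
and the `r` vertices of `K` other than `v`, competing for the remaining weight, again have common
light neighbours of constant weight.

Optimality of `√m` is witnessed by graphs with `m` edges between two consecutive complete graphs:
they have `O(√m)` vertices. The statement for fixed `k` follows, since `c √m ≥ k` for large `m`.
-/

/-! ### The quadratic form of the adjacency matrix -/

section Weights

open scoped Classical

variable {V : Type*} [Fintype V]

namespace SimpleGraph

/-- The real indicator of adjacency: the entries of the adjacency matrix, with the decidability of
adjacency fixed to be the classical one. -/
noncomputable def adjInd {V : Type*} (G : SimpleGraph V) (i j : V) : ℝ := if G.Adj i j then 1 else 0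

lemma adjInd_nonneg {V : Type*} (G : SimpleGraph V) (i j : V) : 0 ≤ G.adjInd i j := by
  rw [adjInd]; split_ifs <;> norm_num

lemma adjInd_comm {V : Type*} (G : SimpleGraph V) (i j : V) : G.adjInd i j = G.adjInd j i := by
  simp [adjInd, G.adj_comm]

/-- The quadratic form `∑ i, ∑ j, A i j * x i * x j` of the adjacency matrix `A` of `G`. -/
noncomputable def adjForm (G : SimpleGraph V) (x : V → ℝ) : ℝ :=
  ∑ i, ∑ j, G.adjInd i j * (x i * x j)

lemma adjForm_eq_dotProduct (G : SimpleGraph V) (x : V → ℝ) :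
    G.adjForm x = x ⬝ᵥ (G.adjMatrix ℝ).mulVec x := by
  simp only [adjForm, dotProduct, Matrix.mulVec, Finset.mul_sum]
  exact Finset.sum_congr rfl fun i _ => Finset.sum_congr rfl fun j _ => by
    rw [adjInd, adjMatrix_apply]; ring

/-- The sum of the entries of the adjacency matrix is twice the number of edges. -/
lemma adjForm_one (G : SimpleGraph V) : G.adjForm 1 = 2 * (G.edgeSet.ncard : ℝ) := by
  have h := G.sum_degrees_eq_twice_card_edges
  rw [Set.ncard_eq_toFinset_card']
  have h2 : ((∑ v, G.degree v : ℕ) : ℝ) = 2 * (G.edgeFinset.card : ℝ) := by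
    rw [h]; push_cast; rfl
  rw [show G.edgeSet.toFinset = G.edgeFinset from rfl, ← h2]
  push_cast
  refine Finset.sum_congr rfl fun i _ => ?_
  simp [adjInd, ← card_neighborFinset_eq_degree, neighborFinset_eq_filter]

/-- `λ(G) I - A` is positive semidefinite. -/
lemma posSemidef_adjSpectralRadius_sub (G : SimpleGraph V) :
    (algebraMap ℝ (Matrix V V ℝ) G.adjSpectralRadius - G.adjMatrix ℝ).PosSemidef := by
  rw [Matrix.posSemidef_iff_isHermitian_and_spectrum_nonneg]
  refine ⟨?_, ?_⟩
  · refine Matrix.IsHermitian.sub ?_ (G.isHermitian_adjMatrix ℝ)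
    rw [Matrix.algebraMap_eq_diagonal]
    exact Matrix.isHermitian_diagonal _
  · intro t ht
    rw [← spectrum.singleton_sub_eq] at ht
    obtain ⟨s, hs, μ, hμ, rfl⟩ := Set.mem_sub.mp ht
    rw [Set.mem_singleton_iff] at hs
    subst hs
    have hbdd : BddAbove (spectrum ℝ (G.adjMatrix ℝ)) :=
      (Matrix.finite_real_spectrum (A := G.adjMatrix ℝ)).bddAbove
    exact sub_nonneg.mpr (le_csSup hbdd hμ)

lemma adjForm_le (G : SimpleGraph V) (x : V → ℝ) :
    G.adjForm x ≤ G.adjSpectralRadius * ∑ i, x i ^ 2 := by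
  have h := G.posSemidef_adjSpectralRadius_sub.dotProduct_mulVec_nonneg x
  rw [Matrix.sub_mulVec, dotProduct_sub, Algebra.algebraMap_eq_smul_one, Matrix.smul_mulVec,
    Matrix.one_mulVec] at h
  simp only [star_trivial, dotProduct_smul, smul_eq_mul, ← adjForm_eq_dotProduct] at h
  have h2 : x ⬝ᵥ x = ∑ i, x i ^ 2 := Finset.sum_congr rfl fun i _ => (sq (x i)).symm
  rw [h2] at h
  linarith

lemma adjSpectralRadius_nonneg (G : SimpleGraph V) : 0 ≤ G.adjSpectralRadius := by
  cases isEmpty_or_nonempty V with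
  | inl h =>
    simp [adjSpectralRadius]
  | inr h =>
    obtain ⟨v⟩ := h
    have h := G.adjForm_le (Pi.single v 1)
    have h1 : ∑ i, (Pi.single v 1 : V → ℝ) i ^ 2 = 1 := by
      simp [Pi.single_apply, ite_pow]
    have h2 : 0 ≤ G.adjForm (Pi.single v 1) := by
      refine Finset.sum_nonneg fun i _ => Finset.sum_nonneg fun j _ => ?_
      refine mul_nonneg (G.adjInd_nonneg i j) (mul_nonneg ?_ ?_) <;>
      · rw [Pi.single_apply]; split_ifs <;> norm_num
    rw [h1, mul_one] at h
    exact h2.trans h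

/-- A nonnegative unit eigenvector for the spectral radius. -/
structure IsPerronVector (G : SimpleGraph V) (x : V → ℝ) : Prop where
  nonneg : ∀ v, 0 ≤ x v
  sum_sq : ∑ v, x v ^ 2 = 1
  eigen : ∀ v, ∑ j, G.adjInd v j * x j = G.adjSpectralRadius * x v

lemma exists_isPerronVector [Nonempty V] (G : SimpleGraph V) :
    ∃ x : V → ℝ, G.IsPerronVector x := by
  have hA := G.isHermitian_adjMatrix ℝ
  have hne : (spectrum ℝ (G.adjMatrix ℝ)).Nonempty := by
    rw [hA.spectrum_real_eq_range_eigenvalues]; exact Set.range_nonempty _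
  have hmem : G.adjSpectralRadius ∈ spectrum ℝ (G.adjMatrix ℝ) :=
    hne.csSup_mem (Matrix.finite_real_spectrum (A := G.adjMatrix ℝ))
  rw [hA.spectrum_real_eq_range_eigenvalues] at hmem
  obtain ⟨i, hi⟩ := hmem
  set z : V → ℝ := (hA.eigenvectorBasis i).ofLp with hz
  have hz1 : ∑ v, z v ^ 2 = 1 := by
    have h := hA.eigenvectorBasis.orthonormal.1 i
    have h2 := EuclideanSpace.norm_sq_eq (hA.eigenvectorBasis i)
    rw [h] at h2
    simpa using h2.symm
  have hzA : G.adjForm z = G.adjSpectralRadius := by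
    rw [adjForm_eq_dotProduct, hz, hA.mulVec_eigenvectorBasis i, hi, dotProduct_smul]
    have h2 : z ⬝ᵥ z = 1 := by
      rw [← hz1]; exact Finset.sum_congr rfl fun i _ => (sq (z i)).symm
    rw [h2, smul_eq_mul, mul_one]
  -- Passing to absolute values does not decrease the form, so `|z|` is a maximizer as well.
  set x : V → ℝ := fun v => |z v| with hx
  have hx1 : ∑ v, x v ^ 2 = 1 := by simpa [hx] using hz1
  have hxA : G.adjForm x = G.adjSpectralRadius := by
    refine le_antisymm (by simpa [hx1] using G.adjForm_le x) ?_
    rw [← hzA]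
    refine Finset.sum_le_sum fun i _ => Finset.sum_le_sum fun j _ => ?_
    refine mul_le_mul_of_nonneg_left ?_ (G.adjInd_nonneg i j)
    rw [hx, ← abs_mul]; exact le_abs_self _
  refine ⟨x, fun v => abs_nonneg _, hx1, ?_⟩
  have hps := G.posSemidef_adjSpectralRadius_sub
  have h0 : (algebraMap ℝ (Matrix V V ℝ) G.adjSpectralRadius - G.adjMatrix ℝ).mulVec x = 0 := by
    rw [← hps.dotProduct_mulVec_zero_iff, Matrix.sub_mulVec, dotProduct_sub,
      Algebra.algebraMap_eq_smul_one, Matrix.smul_mulVec, Matrix.one_mulVec]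
    have h2 : x ⬝ᵥ x = 1 := by
      rw [← hx1]; exact Finset.sum_congr rfl fun i _ => (sq (x i)).symm
    simp [dotProduct_smul, ← adjForm_eq_dotProduct, hxA, h2]
  intro v
  have := congrFun h0 v
  rw [Matrix.sub_mulVec, Algebra.algebraMap_eq_smul_one, Matrix.smul_mulVec,
    Matrix.one_mulVec] at this
  simp only [Pi.sub_apply, Pi.smul_apply, smul_eq_mul, Pi.zero_apply, sub_eq_zero] at this
  rw [this]
  refine Finset.sum_congr rfl fun j _ => ?_
  simp [adjInd, adjMatrix_apply]

/-- Cauchy–Schwarz over the edges: the form at `x` is bounded through the form at `x²`. -/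
lemma adjForm_sq_le (G : SimpleGraph V) (x : V → ℝ) :
    G.adjForm x ^ 2 ≤ 2 * (G.edgeSet.ncard : ℝ) * G.adjForm fun v => x v ^ 2 := by
  rw [← G.adjForm_one]
  simp only [adjForm, ← Fintype.sum_prod_type', Pi.one_apply, mul_one]
  refine Finset.sum_sq_le_sum_mul_sum_of_sq_le_mul _ (fun p _ => G.adjInd_nonneg p.1 p.2)
    (fun p _ => mul_nonneg (G.adjInd_nonneg p.1 p.2)
      (mul_nonneg (sq_nonneg (x p.1)) (sq_nonneg (x p.2)))) fun p _ => le_of_eq ?_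
  ring

lemma adjForm_deleteEdges_singleton (G : SimpleGraph V) {u v : V} (h : G.Adj u v) (x : V → ℝ) :
    (G.deleteEdges {s(u, v)}).adjForm x = G.adjForm x - 2 * (x u * x v) := by
  have hne := h.ne
  have key : ∀ i j, (G.deleteEdges {s(u, v)}).adjInd i j * (x i * x j) =
      G.adjInd i j * (x i * x j) - (if i = u then (if j = v then x u * x v else 0) else 0)
        - (if i = v then (if j = u then x u * x v else 0) else 0) := by
    intro i j
    simp only [adjInd, deleteEdges_adj, Set.mem_singleton_iff, Sym2.eq_iff]
    by_cases h1 : i = u ∧ j = v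
    · obtain ⟨rfl, rfl⟩ := h1; simp [h, hne]
    · by_cases h2 : i = v ∧ j = u
      · obtain ⟨rfl, rfl⟩ := h2; simp [h.symm, hne.symm, mul_comm]
      · simp only [h1, h2, or_self, not_false_eq_true, and_true]
        rw [← ite_and, ← ite_and, if_neg h1, if_neg h2]; ring
  simp only [adjForm, key, Finset.sum_sub_distrib]
  simp
  ring

lemma adjForm_deleteIncidenceSet (G : SimpleGraph V) (v : V) (x : V → ℝ) :
    (G.deleteIncidenceSet v).adjForm x =
      G.adjForm x - 2 * (x v * ∑ j, G.adjInd v j * x j) := by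
  have key : ∀ i j, (G.deleteIncidenceSet v).adjInd i j * (x i * x j) =
      G.adjInd i j * (x i * x j)
        - (if i = v then G.adjInd v j * (x v * x j) else 0)
        - (if j = v then G.adjInd v i * (x v * x i) else 0) := by
    intro i j
    simp only [adjInd, deleteIncidenceSet_adj]
    by_cases h1 : i = v
    · subst h1
      by_cases h2 : j = i
      · subst h2; simp
      · simp [h2]
    · by_cases h2 : j = v
      · subst h2; simp [h1, G.adj_comm, mul_comm]
      · simp [h1, h2]
  simp only [adjForm, key, Finset.sum_sub_distrib]
  simp only [Finset.sum_ite_eq', Finset.mem_univ, if_true]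
  have h3 : ∑ i, ∑ j, (if i = v then G.adjInd v j * (x v * x j) else 0) =
      x v * ∑ j, G.adjInd v j * x j := by
    rw [Finset.sum_comm]
    simp only [Finset.sum_ite_eq', Finset.mem_univ, if_true, Finset.mul_sum]
    exact Finset.sum_congr rfl fun i _ => by ring
  have h4 : ∑ i, G.adjInd v i * (x v * x i) = x v * ∑ j, G.adjInd v j * x j := by
    rw [Finset.mul_sum]
    exact Finset.sum_congr rfl fun i _ => by ring
  rw [h3, h4]; ring

end SimpleGraph
end Weights

/-! ### Weighted cliques and books -/

section Cliques

open scoped Classical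

variable {V : Type*}

namespace SimpleGraph

/-- **Weighted Turán theorem.** If the `y`-weighted edge density of `G` on `s` exceeds
`1 - 1 / (r + 1)`, then `s` contains a clique on `r + 2` vertices. -/
theorem exists_isNClique_of_weighted_density (G : SimpleGraph V) (y : V → ℝ) (hy : ∀ v, 0 ≤ y v)
    (r : ℕ) (s : Finset V)
    (h : (1 - 1 / ((r : ℝ) + 1)) * (∑ i ∈ s, y i) ^ 2 <
      ∑ i ∈ s, ∑ j ∈ s, G.adjInd i j * (y i * y j)) :
    ∃ t ⊆ s, G.IsNClique (r + 2) t := by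
  induction r generalizing s with
  | zero =>
    by_contra hcon
    push Not at hcon
    refine absurd h (not_lt.mpr ?_)
    have h0 : ∑ i ∈ s, ∑ j ∈ s, G.adjInd i j * (y i * y j) = 0 := by
      refine Finset.sum_eq_zero fun i hi => Finset.sum_eq_zero fun j hj => ?_
      have hnot : ¬ G.Adj i j := fun hadj => by
        refine hcon {i, j} (by simp [Finset.insert_subset_iff, hi, hj]) ?_
        rw [isNClique_iff]
        exact ⟨by simpa [isClique_iff, Set.pairwise_pair, hadj.symm] using fun _ => hadj,
          Finset.card_pair hadj.ne⟩
      simp [adjInd, hnot]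
    rw [h0]; simp
  | succ r ih =>
    have hs : s.Nonempty := by
      rw [Finset.nonempty_iff_ne_empty]; rintro rfl; simp at h
    set deg : V → ℝ := fun i => ∑ j ∈ s, G.adjInd i j * y j with hdeg
    -- Split at the neighbourhood `N` of a vertex `v` of largest weighted degree.
    obtain ⟨v, hv, hmax⟩ := s.exists_max_image deg hs
    set N := s.filter (G.Adj v) with hN
    set B := s.filter (fun j => ¬ G.Adj v j) with hB
    have hd : deg v = ∑ j ∈ N, y j := by
      simp only [hdeg, hN, Finset.sum_filter, adjInd]
      exact Finset.sum_congr rfl fun j _ => by split_ifs <;> simp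
    have hYB : ∑ i ∈ s, y i = deg v + ∑ i ∈ B, y i := by
      rw [hd, hN, hB, Finset.sum_filter_add_sum_filter_not]
    by_cases hden : (1 - 1 / ((r : ℝ) + 1)) * (∑ i ∈ N, y i) ^ 2 <
        ∑ i ∈ N, ∑ j ∈ N, G.adjInd i j * (y i * y j)
    · obtain ⟨t, htN, ht⟩ := ih N hden
      refine ⟨insert v t, ?_, ?_⟩
      · refine Finset.insert_subset hv (htN.trans (Finset.filter_subset _ _))
      · exact ht.insert fun b hb => (Finset.mem_filter.mp (htN hb)).2
    · exfalso
      rw [not_lt, ← hd] at hden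
      have hsplit : ∑ i ∈ s, ∑ j ∈ s, G.adjInd i j * (y i * y j) ≤
          ∑ i ∈ N, ∑ j ∈ N, G.adjInd i j * (y i * y j) + 2 * ∑ i ∈ B, y i * deg i := by
        have e1 : ∀ i, ∑ j ∈ s, G.adjInd i j * (y i * y j) =
            ∑ j ∈ N, G.adjInd i j * (y i * y j) + ∑ j ∈ B, G.adjInd i j * (y i * y j) := fun i =>
          (Finset.sum_filter_add_sum_filter_not s (G.Adj v) _).symm
        have e2 : ∑ i ∈ s, ∑ j ∈ s, G.adjInd i j * (y i * y j) =
            ∑ i ∈ N, ∑ j ∈ s, G.adjInd i j * (y i * y j) +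
              ∑ i ∈ B, ∑ j ∈ s, G.adjInd i j * (y i * y j) :=
          (Finset.sum_filter_add_sum_filter_not s (G.Adj v) _).symm
        have e3 : ∑ i ∈ B, ∑ j ∈ s, G.adjInd i j * (y i * y j) = ∑ i ∈ B, y i * deg i := by
          refine Finset.sum_congr rfl fun i _ => ?_
          rw [hdeg, Finset.mul_sum]
          exact Finset.sum_congr rfl fun j _ => by ring
        have e4 : ∑ i ∈ N, ∑ j ∈ B, G.adjInd i j * (y i * y j) ≤ ∑ i ∈ B, y i * deg i := by
          rw [Finset.sum_comm, ← e3]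
          refine Finset.sum_le_sum fun i _ => ?_
          refine (Finset.sum_le_sum_of_subset_of_nonneg (Finset.filter_subset _ _)
            fun j _ _ => ?_).trans (le_of_eq (Finset.sum_congr rfl fun j _ => ?_))
          · exact mul_nonneg (G.adjInd_nonneg _ _) (mul_nonneg (hy _) (hy _))
          · rw [G.adjInd_comm]; ring
        rw [e2, e3, Finset.sum_congr rfl fun i _ => e1 i, Finset.sum_add_distrib]
        linarith
      have hB2 : ∑ i ∈ B, y i * deg i ≤ (∑ i ∈ B, y i) * deg v := by
        rw [Finset.sum_mul]
        exact Finset.sum_le_sum fun i hi =>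
          mul_le_mul_of_nonneg_left (hmax i (Finset.mem_filter.mp hi).1) (hy i)
      rw [hYB] at h
      push_cast at h
      set d := deg v
      set b := ∑ i ∈ B, y i
      have hr : (0 : ℝ) ≤ r := r.cast_nonneg
      have hlt : (1 - 1 / ((r : ℝ) + 1 + 1)) * (d + b) ^ 2 <
          (1 - 1 / ((r : ℝ) + 1)) * d ^ 2 + 2 * (b * d) := by linarith
      have hid : (1 - 1 / ((r : ℝ) + 1 + 1)) * (d + b) ^ 2 -
          ((1 - 1 / ((r : ℝ) + 1)) * d ^ 2 + 2 * (b * d)) =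
          (d - (r + 1) * b) ^ 2 / ((r + 1) * (r + 2)) := by
        field_simp
        ring
      have hpos : 0 ≤ (d - (r + 1) * b) ^ 2 / (((r : ℝ) + 1) * (r + 2)) := by positivity
      linarith

/-- An `r`-clique with `k` common neighbours spans a generalized book. -/
lemma isContained_generalizedBook (G : SimpleGraph V) {r k : ℕ} {R Z : Finset V}
    (hR : G.IsNClique r R) (hZ : Z.card = k) (hRZ : ∀ a ∈ R, ∀ z ∈ Z, G.Adj a z) :
    (generalizedBook r k).IsContained G := by
  have hR' := (isNClique_iff G).mp hR
  let e := (Finset.equivFinOfCardEq hR'.2).symm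
  let f := (Finset.equivFinOfCardEq hZ).symm
  have hne : ∀ i j, (e i : V) ≠ f j := fun i j => (hRZ _ (e i).2 _ (f j).2).ne
  refine ⟨⟨⟨Sum.elim (fun i => (e i : V)) (fun j => (f j : V)), ?_⟩, ?_⟩⟩
  · rintro (a | a) (b | b) hab
    · have hab' : a ≠ b := by simpa [generalizedBook, joinGraph] using hab
      exact hR'.1 (e a).2 (e b).2 fun h => hab' (e.injective (Subtype.ext h))
    · exact hRZ _ (e a).2 _ (f b).2
    · exact (hRZ _ (e b).2 _ (f a).2).symm
    · simp [generalizedBook, joinGraph] at hab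
  · rintro (a | a) (b | b) hab
    · exact congrArg _ (e.injective (Subtype.ext hab))
    · exact absurd hab (hne a b)
    · exact absurd hab.symm (hne b a)
    · exact congrArg _ (f.injective (Subtype.ext hab))

lemma generalizedBook_isContained_of_le {r k l : ℕ} (h : k ≤ l) :
    (generalizedBook r k).IsContained (generalizedBook r l) := by
  refine ⟨⟨⟨Sum.map id (Fin.castLE h), ?_⟩, ?_⟩⟩
  · rintro (a | a) (b | b) hab <;> revert hab <;> simp [generalizedBook, joinGraph]
  · exact Function.Injective.sumMap Function.injective_id (Fin.castLE_injective h)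

/-- If the vertices of a clique `K` on at most `r + 1` vertices have total weight into `W`
exceeding `(r - 1) * y(W)` by `2 * c`, and each vertex of `W` has weight at most `b`, then some
`r` of them have at least `c / (b * (r + 1))` common neighbours: the vertices of `W` with `r`
neighbours in `K` have total weight at least `c`, and `K` has at most `r + 1` subsets of size
`r`. -/
lemma exists_generalizedBook_of_weight (G : SimpleGraph V) {r : ℕ} {K W : Finset V}
    (hK : G.IsClique (K : Set V)) (hKl : r ≤ K.card) (hKu : K.card ≤ r + 1) (y : V → ℝ)
    (hy : ∀ v, 0 ≤ y v) {b c : ℝ} (hb : 0 < b) (hyb : ∀ v ∈ W, y v ≤ b)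
    (hc : ((r : ℝ) - 1) * ∑ u ∈ W, y u + 2 * c ≤
      ∑ v ∈ K, ∑ u ∈ W, G.adjInd v u * y u) :
    ∃ k : ℕ, c / (b * (r + 1)) ≤ k ∧ (generalizedBook r k).IsContained G := by
  set nb : V → Finset V := fun u => K.filter fun v => G.Adj v u with hnb
  set Z := W.filter fun u => r ≤ (nb u).card with hZ
  have hZw : c ≤ ∑ u ∈ Z, y u := by
    have h1 : ∑ v ∈ K, ∑ u ∈ W, G.adjInd v u * y u = ∑ u ∈ W, ((nb u).card : ℝ) * y u := by
      rw [Finset.sum_comm]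
      refine Finset.sum_congr rfl fun u _ => ?_
      rw [← Finset.sum_mul]
      simp [adjInd, hnb]
    have h2 : ∑ u ∈ W, ((nb u).card : ℝ) * y u ≤
        ((r : ℝ) - 1) * ∑ u ∈ W, y u + 2 * ∑ u ∈ Z, y u := by
      rw [hZ, Finset.sum_filter, Finset.mul_sum, Finset.mul_sum, ← Finset.sum_add_distrib]
      refine Finset.sum_le_sum fun u _ => ?_
      split_ifs with h
      · have : ((nb u).card : ℝ) ≤ r + 1 := by
          exact_mod_cast (Finset.card_le_card (Finset.filter_subset _ _)).trans hKu
        nlinarith [hy u]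
      · have : ((nb u).card : ℝ) ≤ r - 1 := by
          rw [le_sub_iff_add_le]; exact_mod_cast (not_le.mp h)
        nlinarith [hy u]
    linarith
  have hZc : c / b ≤ Z.card := by
    rw [div_le_iff₀ hb]
    refine hZw.trans ((Finset.sum_le_card_nsmul Z y b fun u hu =>
      hyb u (Finset.mem_filter.mp hu).1).trans_eq ?_)
    rw [nsmul_eq_mul]
  -- Pigeonhole over the `r`-subset of `K` chosen among the neighbours of each vertex of `Z`.
  choose! g hg using fun u (hu : r ≤ (nb u).card) => Finset.exists_subset_card_eq hu
  have hmap : ∀ u ∈ Z, g u ∈ K.powersetCard r := fun u hu => by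
    have := hg u (Finset.mem_filter.mp hu).2
    exact Finset.mem_powersetCard.mpr ⟨this.1.trans (Finset.filter_subset _ _), this.2⟩
  have hcard : (K.powersetCard r).card ≤ r + 1 := by
    rw [Finset.card_powersetCard]
    refine (Nat.choose_le_choose r hKu).trans ?_
    rw [Nat.choose_succ_self_right]
  have hne : (K.powersetCard r).Nonempty := Finset.powersetCard_nonempty.mpr hKl
  obtain ⟨R, hR, hRc⟩ := Finset.exists_le_card_fiber_of_nsmul_le_card_of_maps_to
    (t := K.powersetCard r)
    (b := c / (b * (r + 1))) hmap hne (by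
      rw [nsmul_eq_mul]
      rcases le_or_gt c 0 with h0 | h0
      · exact (mul_nonpos_of_nonneg_of_nonpos (Nat.cast_nonneg _)
          (div_nonpos_of_nonpos_of_nonneg h0 (by positivity))).trans (Nat.cast_nonneg _)
      · refine le_trans ?_ hZc
        have h3 : ((K.powersetCard r).card : ℝ) ≤ r + 1 := by exact_mod_cast hcard
        calc _ ≤ ((r : ℝ) + 1) * (c / (b * (r + 1))) :=
              mul_le_mul_of_nonneg_right h3 (by positivity)
          _ = c / b := by field_simp)
  rw [Finset.mem_powersetCard] at hR
  refine ⟨_, hRc, G.isContained_generalizedBook (R := R) ?_ rfl ?_⟩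
  · exact (isNClique_iff G).mpr ⟨hK.subset (by exact_mod_cast hR.1), hR.2⟩
  · intro a ha z hz
    obtain ⟨hz1, rfl⟩ := Finset.mem_filter.mp hz
    exact (Finset.mem_filter.mp ((hg z (Finset.mem_filter.mp hz1).2).1 ha)).2

end SimpleGraph
end Cliques

/-! ### Subgraphs maximizing `λ² - α m` -/

section Critical

open scoped Classical

variable {V : Type*} [Fintype V]

namespace SimpleGraph

/-- `H` is critical for `α` if no subgraph of `H` has a larger value of `λ² - α m`. -/
def IsSpectralCritical (H : SimpleGraph V) (α : ℝ) : Prop :=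
  ∀ H' ≤ H, H'.adjSpectralRadius ^ 2 - α * H'.edgeSet.ncard ≤
    H.adjSpectralRadius ^ 2 - α * H.edgeSet.ncard

lemma exists_isSpectralCritical_le (G : SimpleGraph V) (α : ℝ) :
    ∃ H ≤ G, H.IsSpectralCritical α ∧
      G.adjSpectralRadius ^ 2 - α * G.edgeSet.ncard ≤
        H.adjSpectralRadius ^ 2 - α * H.edgeSet.ncard := by
  obtain ⟨H, hH, hmax⟩ := Set.exists_max_image {H : SimpleGraph V | H ≤ G}
    (fun H => H.adjSpectralRadius ^ 2 - α * H.edgeSet.ncard) (Set.toFinite _) ⟨G, le_refl G⟩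
  exact ⟨H, hH, fun H' h => hmax H' (h.trans hH), hmax G (le_refl G)⟩

namespace IsPerronVector

variable {H : SimpleGraph V} {x : V → ℝ} {α : ℝ}

lemma adjForm_eq (hx : H.IsPerronVector x) : H.adjForm x = H.adjSpectralRadius := by
  have : ∀ i, ∑ j, H.adjInd i j * (x i * x j) = H.adjSpectralRadius * x i ^ 2 := fun i => by
    rw [sq, ← mul_assoc, ← hx.eigen i, Finset.sum_mul]
    exact Finset.sum_congr rfl fun j _ => by ring
  rw [adjForm, Finset.sum_congr rfl fun i _ => this i, ← Finset.mul_sum, hx.sum_sq, mul_one]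

lemma sq_le_one (hx : H.IsPerronVector x) (v : V) : x v ^ 2 ≤ 1 := by
  rw [← hx.sum_sq]
  exact Finset.single_le_sum (f := fun v => x v ^ 2) (fun i _ => sq_nonneg _) (Finset.mem_univ v)

/-- Deleting an edge shows that in a critical graph no edge carries too little weight. -/
lemma le_of_adj (hx : H.IsPerronVector x) (hc : H.IsSpectralCritical α) {u v : V}
    (h : H.Adj u v) : α ≤ 4 * H.adjSpectralRadius * (x u * x v) := by
  have h1 := hc (H.deleteEdges {s(u, v)}) (deleteEdges_le _)
  have h2 := H.adjForm_deleteEdges_singleton h 1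
  have h3 := H.adjForm_deleteEdges_singleton h x
  have h4 := (H.deleteEdges {s(u, v)}).adjForm_le x
  rw [adjForm_one, adjForm_one] at h2
  simp only [Pi.one_apply, mul_one] at h2
  rw [hx.sum_sq, mul_one, h3, hx.adjForm_eq] at h4
  have h5 : 0 ≤ H.adjForm x - 2 * (x u * x v) := by
    rw [← h3]
    exact Finset.sum_nonneg fun i _ => Finset.sum_nonneg fun j _ =>
      mul_nonneg (adjInd_nonneg _ _ _) (mul_nonneg (hx.nonneg i) (hx.nonneg j))
  rw [hx.adjForm_eq] at h5
  have h6 := pow_le_pow_left₀ h5 h4 2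
  have h7 : ((H.deleteEdges {s(u, v)}).edgeSet.ncard : ℝ) = H.edgeSet.ncard - 1 := by linarith
  rw [h7] at h1
  nlinarith [sq_nonneg (x u * x v)]

/-- Deleting all edges at `v` shows that in a critical graph the weight `x v ^ 2` is at least about
`α d(v) / (2 λ²)`. The correction `1 - x v ^ 2 / 2` is the loss from renormalizing the eigenvector
once its coordinate at `v` is dropped. -/
lemma degree_le (hx : H.IsPerronVector x) (hc : H.IsSpectralCritical α) (v : V) :
    α * (∑ j, H.adjInd v j) * (1 - x v ^ 2 / 2) ≤ 2 * H.adjSpectralRadius ^ 2 * x v ^ 2 := by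
  set l := H.adjSpectralRadius with hl
  have hl0 : 0 ≤ l := H.adjSpectralRadius_nonneg
  set D := H.deleteIncidenceSet v with hD
  have h1 := hc D (deleteIncidenceSet_le _ _)
  have h2 := H.adjForm_deleteIncidenceSet v 1
  have h3 := H.adjForm_deleteIncidenceSet v x
  rw [adjForm_one, adjForm_one] at h2
  simp only [Pi.one_apply, mul_one, one_mul] at h2
  rw [hx.eigen, hx.adjForm_eq] at h3
  have h5 : 0 ≤ D.adjForm x :=
    Finset.sum_nonneg fun i _ => Finset.sum_nonneg fun j _ =>
      mul_nonneg (adjInd_nonneg _ _ _) (mul_nonneg (hx.nonneg i) (hx.nonneg j))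
  -- Zeroing the coordinate at `v` does not change the form but decreases the norm.
  set z : V → ℝ := fun i => if i = v then 0 else x i with hz
  have hzx : D.adjForm z = D.adjForm x := by
    refine Finset.sum_congr rfl fun i _ => Finset.sum_congr rfl fun j _ => ?_
    simp only [hz, adjInd, hD, deleteIncidenceSet_adj]
    by_cases hi : i = v <;> by_cases hj : j = v <;> simp [hi, hj]
  have hzn : ∑ i, z i ^ 2 = 1 - x v ^ 2 := by
    have : ∀ i, z i ^ 2 = x i ^ 2 - if i = v then x v ^ 2 else 0 := fun i => by
      simp only [hz]; split_ifs with h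
      · subst h; simp
      · simp
    simp [this, Finset.sum_sub_distrib, hx.sum_sq]
  have h4 := D.adjForm_le z
  rw [hzx, hzn, h3] at h4
  rw [h3] at h5
  have h7 : (D.edgeSet.ncard : ℝ) = H.edgeSet.ncard - ∑ j, H.adjInd v j := by linarith
  rw [h7] at h1
  have hy1 := hx.sq_le_one v
  have h6 := pow_le_pow_left₀ h5 h4 2
  set d := ∑ j, H.adjInd v j
  set t := D.adjSpectralRadius
  generalize hy : x v ^ 2 = y at *
  have hy0 : 0 ≤ y := hy ▸ sq_nonneg _
  have e : l - 2 * (x v * (l * x v)) = l * (1 - 2 * y) := by rw [← hy]; ring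
  rw [e] at h6 h5
  have h8 : α * d ≤ l ^ 2 - t ^ 2 := by linarith
  rcases eq_or_lt_of_le hy1 with rfl | hlt
  · have hl' : l = 0 := by linarith
    have : 0 ≤ t ^ 2 := sq_nonneg t
    rw [hl'] at h8 ⊢
    linarith
  · -- `h9` is the bound that renormalization gives; the rest uses
    -- `(2 - 3 * y) * (1 - y / 2) ≤ 2 * (1 - y) ^ 2`.
    have h9 : α * d * (1 - y) ^ 2 ≤ l ^ 2 * (y * (2 - 3 * y)) := by
      have := mul_le_mul_of_nonneg_right h8 (sq_nonneg (1 - y))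
      nlinarith
    have hp : 0 < (1 - y) ^ 2 := by have : 0 < 1 - y := by linarith
                                    positivity
    have h10 : α * d * (1 - y / 2) * (1 - y) ^ 2 ≤ 2 * l ^ 2 * y * (1 - y) ^ 2 := by
      have h11 := mul_le_mul_of_nonneg_right h9 (show 0 ≤ 1 - y / 2 by linarith)
      have h12 : 0 ≤ l ^ 2 * y ^ 3 := by positivity
      nlinarith
    exact le_of_mul_le_mul_right h10 hp

/-- A set `S` that is small compared with `λ² x_v²` carries little of the sum
`∑_{j ∼ v} x_j = λ x_v`, so by Cauchy–Schwarz the neighbours outside `S` have large weight. -/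
lemma sq_mul_le_weight_compl (hx : H.IsPerronVector x) (v : V) (S : Finset V) {δ : ℝ}
    (hδ0 : 0 ≤ δ) (hδ1 : δ ≤ 1)
    (hS : (S.card : ℝ) ≤ δ ^ 2 * H.adjSpectralRadius ^ 2 * x v ^ 2) :
    (1 - δ) ^ 2 * (H.adjSpectralRadius ^ 2 * x v ^ 2) ≤
      (∑ j, H.adjInd v j) * ∑ j ∈ Sᶜ, H.adjInd v j * x j ^ 2 := by
  set l := H.adjSpectralRadius with hl
  have hl0 : 0 ≤ l := H.adjSpectralRadius_nonneg
  have hlx : 0 ≤ l * x v := mul_nonneg hl0 (hx.nonneg v)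
  have hle1 : ∀ j, H.adjInd v j ≤ 1 := fun j => by rw [adjInd]; split_ifs <;> norm_num
  have h1 : ∑ j ∈ S, H.adjInd v j * x j ≤ δ * (l * x v) := by
    refine (Finset.sum_le_sum fun j _ => mul_le_of_le_one_left (hx.nonneg j) (hle1 j)).trans ?_
    refine le_of_abs_le (abs_le_of_sq_le_sq ?_ (mul_nonneg hδ0 hlx))
    have h2 := sq_sum_le_card_mul_sum_sq (s := S) (f := x)
    have h3 : ∑ j ∈ S, x j ^ 2 ≤ 1 := by
      rw [← hx.sum_sq]
      exact Finset.sum_le_sum_of_subset_of_nonneg (Finset.subset_univ _) fun _ _ _ => sq_nonneg _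
    calc (∑ j ∈ S, x j) ^ 2 ≤ S.card * ∑ j ∈ S, x j ^ 2 := h2
      _ ≤ S.card * 1 := by gcongr
      _ ≤ (δ * (l * x v)) ^ 2 := by rw [mul_one]; refine hS.trans_eq ?_; ring
  have h2 : (1 - δ) * (l * x v) ≤ ∑ j ∈ Sᶜ, H.adjInd v j * x j := by
    have := Finset.sum_add_sum_compl S fun j => H.adjInd v j * x j
    rw [hx.eigen, ← hl] at this
    linarith
  have h3 : (∑ j ∈ Sᶜ, H.adjInd v j * x j) ^ 2 ≤
      (∑ j ∈ Sᶜ, H.adjInd v j) * ∑ j ∈ Sᶜ, H.adjInd v j * x j ^ 2 :=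
    Finset.sum_sq_le_sum_mul_sum_of_sq_le_mul _ (fun j _ => H.adjInd_nonneg _ _)
      (fun j _ => mul_nonneg (H.adjInd_nonneg _ _) (sq_nonneg _)) fun j _ => le_of_eq (by ring)
  have h4 : ∑ j ∈ Sᶜ, H.adjInd v j ≤ ∑ j, H.adjInd v j :=
    Finset.sum_le_sum_of_subset_of_nonneg (Finset.subset_univ _) fun _ _ _ => H.adjInd_nonneg _ _
  calc (1 - δ) ^ 2 * (l ^ 2 * x v ^ 2) = ((1 - δ) * (l * x v)) ^ 2 := by ring
    _ ≤ (∑ j ∈ Sᶜ, H.adjInd v j * x j) ^ 2 :=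
      pow_le_pow_left₀ (mul_nonneg (by linarith) hlx) h2 2
    _ ≤ _ := h3
    _ ≤ _ := mul_le_mul_of_nonneg_right h4
      (Finset.sum_nonneg fun j _ => mul_nonneg (H.adjInd_nonneg _ _) (sq_nonneg _))

/-- In a critical graph, the neighbours of a non-isolated vertex `v` outside a small set `S` have
weight at least about `α / 2`. -/
lemma le_weight_compl (hx : H.IsPerronVector x) (hc : H.IsSpectralCritical α) {u v : V}
    (hadj : H.Adj v u) (S : Finset V) {δ : ℝ} (hδ0 : 0 ≤ δ) (hδ1 : δ ≤ 1)
    (hS : (S.card : ℝ) ≤ δ ^ 2 * H.adjSpectralRadius ^ 2 * x v ^ 2) :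
    (1 - δ) ^ 2 * (α / 2) * (1 - x v ^ 2 / 2) ≤ ∑ j ∈ Sᶜ, H.adjInd v j * x j ^ 2 := by
  have h1 := hx.degree_le hc v
  have h2 := hx.sq_mul_le_weight_compl v S hδ0 hδ1 hS
  have hd : 0 < ∑ j, H.adjInd v j :=
    Finset.sum_pos' (fun j _ => H.adjInd_nonneg _ _) ⟨u, Finset.mem_univ _, by simp [adjInd, hadj]⟩
  set d := ∑ j, H.adjInd v j
  refine le_of_mul_le_mul_left ?_ hd
  refine le_trans ?_ h2
  have := mul_le_mul_of_nonneg_left h1 (sq_nonneg (1 - δ))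
  linarith

/-- `x v ^ 2 ≤ 1 / 2`: the edges at `v` contribute `2 λ x_v²` to the form `λ`. -/
lemma sq_le_half (hx : H.IsPerronVector x) (hl : 0 < H.adjSpectralRadius) (v : V) :
    x v ^ 2 ≤ 1 / 2 := by
  have h3 := H.adjForm_deleteIncidenceSet v x
  have h5 : 0 ≤ (H.deleteIncidenceSet v).adjForm x :=
    Finset.sum_nonneg fun i _ => Finset.sum_nonneg fun j _ =>
      mul_nonneg (adjInd_nonneg _ _ _) (mul_nonneg (hx.nonneg i) (hx.nonneg j))
  rw [h3, hx.eigen, hx.adjForm_eq] at h5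
  refine le_of_mul_le_mul_left ?_ hl
  nlinarith

/-- At most `1 / θ` vertices have weight at least `θ`. -/
lemma card_mul_le_one (hx : H.IsPerronVector x) (θ : ℝ) :
    ((Finset.univ.filter fun v => θ ≤ x v ^ 2).card : ℝ) * θ ≤ 1 := by
  rw [← nsmul_eq_mul, ← hx.sum_sq]
  refine (Finset.card_nsmul_le_sum _ (fun v => x v ^ 2) θ
    fun v hv => (Finset.mem_filter.mp hv).2).trans ?_
  exact Finset.sum_le_sum_of_subset_of_nonneg (Finset.subset_univ _) fun _ _ _ => sq_nonneg _

/-- A graph with `λ² > (1 - 1/r) 2m` contains a clique on `r + 1` vertices. -/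
lemma exists_isNClique (hx : H.IsPerronVector x) {r : ℕ} (hr : 1 ≤ r)
    (h : (1 - 1 / (r : ℝ)) * (2 * (H.edgeSet.ncard : ℝ)) < H.adjSpectralRadius ^ 2) :
    ∃ t : Finset V, H.IsNClique (r + 1) t := by
  obtain ⟨q, rfl⟩ : ∃ q, r = q + 1 := ⟨r - 1, by omega⟩
  have h1 := H.adjForm_sq_le x
  rw [hx.adjForm_eq] at h1
  have h2 := h.trans_le h1
  have hm : (0 : ℝ) ≤ 2 * (H.edgeSet.ncard : ℝ) := by positivity
  rw [mul_comm] at h2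
  have h3 := lt_of_mul_lt_mul_left h2 hm
  obtain ⟨t, -, ht⟩ := H.exists_isNClique_of_weighted_density (fun v => x v ^ 2)
    (fun v => sq_nonneg _) q Finset.univ (by
      simp only [hx.sum_sq, one_pow, mul_one]
      push_cast at h3
      exact h3)
  exact ⟨t, ht⟩

end IsPerronVector

end SimpleGraph
end Critical

/-! ### Books of size of order `√m` -/

section Books

open scoped Classical

variable {V : Type*} [Fintype V]

namespace SimpleGraph

/-- A critical graph with `λ² > (1 - 1/r) 2m` contains a generalized book of size linear in `λ`. -/
theorem IsSpectralCritical.exists_generalizedBook {H : SimpleGraph V} {r : ℕ} (hr : 2 ≤ r)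
    (hc : H.IsSpectralCritical (2 * ((1 - 1 / (r : ℝ)) * (1 - 1 / (24 * r)))))
    (h : (1 - 1 / (r : ℝ)) * (2 * (H.edgeSet.ncard : ℝ)) < H.adjSpectralRadius ^ 2) :
    ∃ k : ℕ, (1 / (24 * (r : ℝ))) ^ 3 / (1600 * (r + 1)) * H.adjSpectralRadius ≤ k ∧
      (generalizedBook r k).IsContained H := by
  set l := H.adjSpectralRadius with hl
  have hr2 : (2 : ℝ) ≤ r := by exact_mod_cast hr
  set ρ : ℝ := 1 / (r : ℝ) with hρ
  have hρr : ρ * r = 1 := by rw [hρ]; field_simp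
  have hρ0 : 0 < ρ := by positivity
  have hρ2 : ρ ≤ 1 / 2 := by rw [hρ]; exact one_div_le_one_div_of_le (by norm_num) hr2
  have hδρ : 1 / (24 * (r : ℝ)) = ρ / 24 := by rw [hρ]; field_simp
  rw [hδρ] at hc ⊢
  set δ : ℝ := ρ / 24 with hδ
  have hδ0 : 0 < δ := by positivity
  have hδ1 : δ ≤ 1 / 48 := by rw [hδ]; linarith
  set κ : ℝ := (1 - ρ) * (1 - δ) with hκ
  have hκ0 : 47 / 96 ≤ κ := by rw [hκ]; nlinarith
  have hl0 : 0 < l := by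
    refine lt_of_le_of_ne H.adjSpectralRadius_nonneg fun h0 => ?_
    change 0 = l at h0
    rw [← h0] at h
    have : 0 ≤ (1 - ρ) * (2 * (H.edgeSet.ncard : ℝ)) :=
      mul_nonneg (by linarith) (by positivity)
    norm_num at h
    linarith
  have hne : Nonempty V := by
    by_contra hemp
    rw [not_nonempty_iff] at hemp
    have : l = 0 := by simp [hl, adjSpectralRadius]
    linarith
  obtain ⟨x, hx⟩ := H.exists_isPerronVector
  obtain ⟨t, ht⟩ := hx.exists_isNClique (by omega) h
  rw [isNClique_iff] at ht
  -- The weight into the complement of a small set `S`, for every non-isolated vertex; the factor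
  -- `1 - ρ / 8 = 1 - 3 * δ` absorbs the three losses of size `1 - δ`.
  have hwt : ∀ (S : Finset V) (v u : V), H.Adj v u →
      (S.card : ℝ) ≤ δ ^ 2 * l ^ 2 * x v ^ 2 →
      (1 - ρ) * (1 - ρ / 8) * (1 - x v ^ 2 / 2) ≤ ∑ j ∈ Sᶜ, H.adjInd v j * x j ^ 2 := by
    intro S v u hadj hS
    refine le_trans ?_ (hx.le_weight_compl hc hadj S hδ0.le (by linarith) hS)
    refine mul_le_mul_of_nonneg_right ?_ (by linarith [hx.sq_le_one v])
    have e : (1 - δ) ^ 2 * (2 * κ / 2) = (1 - ρ) * (1 - δ) ^ 3 := by rw [hκ]; ring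
    rw [e]
    refine mul_le_mul_of_nonneg_left ?_ (by linarith)
    rw [show ρ / 8 = 3 * δ by rw [hδ]; ring]
    have : 0 ≤ δ ^ 2 * (3 - δ) := mul_nonneg (sq_nonneg _) (by linarith)
    linarith
  -- Over any set of vertices the corrections `x v ^ 2 / 2` add up to at most `1 / 2`.
  have hsumwt : ∀ (S K : Finset V) (q : ℝ), (K.card : ℝ) = q → (∀ v ∈ K, ∃ u, H.Adj v u) →
      (∀ v ∈ K, (S.card : ℝ) ≤ δ ^ 2 * l ^ 2 * x v ^ 2) →
      (1 - ρ) * (1 - ρ / 8) * (q - 1 / 2) ≤ ∑ v ∈ K, ∑ j ∈ Sᶜ, H.adjInd v j * x j ^ 2 := by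
    intro S K q hq hK hS
    refine le_trans ?_ (Finset.sum_le_sum fun v hv =>
      let ⟨u, hu⟩ := hK v hv
      hwt S v u hu (hS v hv))
    rw [← Finset.mul_sum, Finset.sum_sub_distrib, Finset.sum_const, nsmul_eq_mul, mul_one, hq,
      ← Finset.sum_div]
    refine mul_le_mul_of_nonneg_left ?_ (mul_nonneg (by linarith) (by linarith))
    have : ∑ v ∈ K, x v ^ 2 ≤ 1 := by
      rw [← hx.sum_sq]
      exact Finset.sum_le_sum_of_subset_of_nonneg (Finset.subset_univ _) fun _ _ _ => sq_nonneg _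
    linarith
  have hcompl : ∀ S : Finset V, ∑ j ∈ Sᶜ, x j ^ 2 = 1 - ∑ j ∈ S, x j ^ 2 := fun S => by
    rw [← hx.sum_sq, ← Finset.sum_add_sum_compl S]; ring
  -- With this `b` at most `1 / b` vertices have weight at least `b`, and
  -- `1 / b = δ ^ 2 * l ^ 2 * (δ / (25 * l))` is what `hwt` allows for vertices that are not light,
  -- those of weight at least `δ / (25 * l)`.
  set b : ℝ := 25 / (δ ^ 3 * l) with hb
  have hb0 : 0 < b := by positivity
  have hconst : δ ^ 3 / (1600 * (r + 1)) * l = 1 / 64 / (b * (r + 1)) := by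
    rw [hb]; field_simp; norm_num
  rw [hconst]
  by_cases hlow : ∀ v ∈ t, δ / (25 * l) ≤ x v ^ 2
  · -- No vertex of the clique is light: use the whole clique, and discard the vertices of weight
    -- at least `b`.
    set S := Finset.univ.filter fun v => b ≤ x v ^ 2 with hS
    refine H.exists_generalizedBook_of_weight (K := t) (W := Sᶜ) ht.1 (by omega) (by omega)
      (fun v => x v ^ 2) (fun v => sq_nonneg _) hb0 (fun v hv => ?_) ?_
    · simp only [hS, Finset.mem_compl, Finset.mem_filter, Finset.mem_univ, true_and, not_le] at hv
      exact hv.le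
    · have h1 := hsumwt S t (r + 1) (by rw [ht.2]; push_cast; rfl) (fun v hv => by
        obtain ⟨u, hu, huv⟩ := Finset.exists_mem_ne (s := t) (by omega) v
        exact ⟨u, ht.1 hv hu huv.symm⟩) (fun v hv => by
        have h2 := hx.card_mul_le_one b
        have h3 : (S.card : ℝ) ≤ δ ^ 2 * l ^ 2 * (δ / (25 * l)) := by
          rw [← le_div_iff₀ hb0] at h2
          refine h2.trans_eq ?_
          rw [hb]; field_simp
        exact h3.trans (mul_le_mul_of_nonneg_left (hlow v hv) (by positivity)))
      refine le_trans ?_ h1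
      rw [hcompl]
      have h4 : 0 ≤ ∑ j ∈ S, x j ^ 2 := Finset.sum_nonneg fun _ _ => sq_nonneg _
      have h5 : 0 ≤ ((r : ℝ) - 1) * ∑ j ∈ S, x j ^ 2 := mul_nonneg (by linarith) h4
      have e : (1 - ρ) * (1 - ρ / 8) * ((r : ℝ) + 1 - 1 / 2) =
          r - 5 / 8 - 7 / 16 * ρ + ρ ^ 2 / 16 := by
        linear_combination (-9 / 8 + ρ / 8) * hρr
      rw [e]
      have h6 : 0 ≤ ρ ^ 2 := sq_nonneg ρ
      linarith
  · -- A light vertex `v` has only heavy neighbours; discard these. The other vertices of the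
    -- clique are heavy, and the discarded set has large weight.
    push Not at hlow
    obtain ⟨v, hv, hvl⟩ := hlow
    set S := Finset.univ.filter fun u => 1 / (δ * l) ≤ x u ^ 2 with hS
    -- The edge condition gives `x v ^ 2 * x u ^ 2 ≥ 1 / (25 * l ^ 2)`.
    have hvS : ∀ u, H.Adj v u → 1 / (δ * l) ≤ x u ^ 2 := by
      intro u hadj
      have h1 := hx.le_of_adj hc hadj
      rw [← hl] at h1
      have h2 : 1 ≤ 5 * l * (x v * x u) := by linarith
      have h3 : 1 ≤ 25 * l ^ 2 * x v ^ 2 * x u ^ 2 := by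
        have := one_le_pow₀ h2 (n := 2)
        linarith
      have h4 : 25 * l ^ 2 * x v ^ 2 ≤ δ * l := by
        rw [lt_div_iff₀ (by positivity)] at hvl
        have := mul_le_mul_of_nonneg_left hvl.le hl0.le
        linarith
      rw [div_le_iff₀ (by positivity)]
      have := mul_le_mul_of_nonneg_right h4 (sq_nonneg (x u))
      linarith
    have hSc : (S.card : ℝ) ≤ δ * l := by
      have := hx.card_mul_le_one (1 / (δ * l))
      rw [mul_one_div, div_le_one (by positivity)] at this
      exact this
    have hadj : ∀ u ∈ t.erase v, H.Adj v u := fun u hu =>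
      ht.1 hv (Finset.mem_of_mem_erase hu) (Finset.ne_of_mem_erase hu).symm
    have hcard : (t.erase v).card = r := by rw [Finset.card_erase_of_mem hv, ht.2]; rfl
    have hSw : κ * (3 / 4) ≤ ∑ j ∈ S, x j ^ 2 := by
      obtain ⟨u, hu⟩ : (t.erase v).Nonempty := by rw [← Finset.card_pos]; omega
      have h1 := hx.le_weight_compl hc (hadj u hu) ∅ (δ := 0) le_rfl zero_le_one (by simp)
      have h2 : ∑ j ∈ (∅ : Finset V)ᶜ, H.adjInd v j * x j ^ 2 ≤ ∑ j ∈ S, x j ^ 2 := by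
        rw [hS, Finset.sum_filter, Finset.compl_empty]
        refine Finset.sum_le_sum fun j _ => ?_
        by_cases hj : H.Adj v j
        · rw [if_pos (hvS j hj)]; simp [adjInd, hj]
        · simp only [adjInd, hj, if_false, zero_mul]; split_ifs <;> positivity
      refine le_trans ?_ (h1.trans h2)
      have h3 := hx.sq_le_half hl0 v
      rw [sub_zero, one_pow, one_mul, mul_div_cancel_left₀ κ two_ne_zero]
      exact mul_le_mul_of_nonneg_left (by linarith) (by linarith)
    refine H.exists_generalizedBook_of_weight (K := t.erase v) (W := Sᶜ)
      (ht.1.subset (by exact_mod_cast t.erase_subset v)) (by omega) (by omega)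
      (fun v => x v ^ 2) (fun v => sq_nonneg _) hb0 (fun u hu => ?_) ?_
    · simp only [hS, Finset.mem_compl, Finset.mem_filter, Finset.mem_univ, true_and, not_le] at hu
      refine hu.le.trans ?_
      rw [hb, div_le_div_iff₀ (by positivity) (by positivity)]
      have h2 : δ ^ 2 * (δ * l) ≤ 1 * (δ * l) :=
        mul_le_mul_of_nonneg_right (pow_le_one₀ hδ0.le (by linarith)) (by positivity)
      have h3 : 0 < δ * l := by positivity
      linarith
    · have h1 := hsumwt S (t.erase v) r (by rw [hcard])
        (fun u hu => ⟨v, (hadj u hu).symm⟩) (fun u hu => by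
          refine hSc.trans ?_
          have := mul_le_mul_of_nonneg_left (hvS u (hadj u hu))
            (show 0 ≤ δ ^ 2 * l ^ 2 by positivity)
          refine le_trans (le_of_eq ?_) this
          field_simp)
      refine le_trans ?_ h1
      rw [hcompl]
      have e : (1 - ρ) * (1 - ρ / 8) * ((r : ℝ) - 1 / 2) =
          r - 13 / 8 + 11 / 16 * ρ - ρ ^ 2 / 16 := by
        linear_combination (-9 / 8 + ρ / 8) * hρr
      rw [e]
      have h5 : ((r : ℝ) - 1) * (κ * (3 / 4)) ≤ ((r : ℝ) - 1) * ∑ j ∈ S, x j ^ 2 :=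
        mul_le_mul_of_nonneg_left hSw (by linarith)
      have h6 : 47 / 48 * (2 - 3 * ρ) ≤ κ * (r - 1) := by
        have e2 : κ * ((r : ℝ) - 1) = (1 - δ) * (r - 2 + ρ) := by
          rw [hκ]; linear_combination (-(1 - δ)) * hρr
        rw [e2]
        have h7 : 2 - 3 * ρ ≤ (r : ℝ) - 2 + ρ := by
          have : 0 ≤ (1 - 2 * ρ) * ((r : ℝ) - 2) := mul_nonneg (by linarith) (by linarith)
          linarith
        exact mul_le_mul (by linarith) h7 (by linarith) (by linarith)
      have h7 : ρ * ρ ≤ 1 / 2 * ρ := mul_le_mul_of_nonneg_right hρ2 hρ0.le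
      linarith

/-- Passing to a critical subgraph: a graph with `m` edges and `λ² > (1 - 1/r) 2m` contains a
generalized book of size of order `√m`. -/
theorem exists_generalizedBook_of_lt_sq {r : ℕ} (hr : 2 ≤ r) :
    ∃ c : ℝ, 0 < c ∧ ∀ (V : Type u) [Fintype V] (G : SimpleGraph V),
      (1 - 1 / (r : ℝ)) * (2 * (G.edgeSet.ncard : ℝ)) < G.adjSpectralRadius ^ 2 →
      ∃ k : ℕ, c * √(G.edgeSet.ncard : ℝ) ≤ k ∧ (generalizedBook r k).IsContained G := by
  have hr2 : (2 : ℝ) ≤ r := by exact_mod_cast hr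
  refine ⟨(1 / (24 * (r : ℝ))) ^ 3 / (1600 * (r + 1)) * √(1 / (24 * r)), by positivity, ?_⟩
  intro V _ G hG
  obtain ⟨H, hHG, hc, hle⟩ :=
    G.exists_isSpectralCritical_le (2 * ((1 - 1 / (r : ℝ)) * (1 - 1 / (24 * r))))
  have hm : (H.edgeSet.ncard : ℝ) ≤ G.edgeSet.ncard := by
    exact_mod_cast Set.ncard_le_ncard (edgeSet_mono hHG)
  have hρ2 : 1 / (r : ℝ) ≤ 1 / 2 := one_div_le_one_div_of_le (by norm_num) hr2
  have hε1 : 1 / (24 * (r : ℝ)) ≤ 1 := by rw [div_le_one (by positivity)]; linarith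
  have hε0 : 0 < 1 / (24 * (r : ℝ)) := by positivity
  have hbook := hc.exists_generalizedBook hr
  generalize 1 / (24 * (r : ℝ)) = ε at *
  set ρ := 1 / (r : ℝ)
  have hm0 : (0 : ℝ) ≤ H.edgeSet.ncard := by positivity
  -- Criticality transfers the surplus of `G` to `H`, with a gain for each deleted edge.
  have hgap : (1 - ρ) * (2 * (H.edgeSet.ncard : ℝ)) +
      2 * (1 - ρ) * ε * (G.edgeSet.ncard - H.edgeSet.ncard) < H.adjSpectralRadius ^ 2 := by
    nlinarith
  have hρε : 0 ≤ 2 * (1 - ρ) * ε := mul_nonneg (by linarith) hε0.le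
  have hH : (1 - ρ) * (2 * (H.edgeSet.ncard : ℝ)) < H.adjSpectralRadius ^ 2 := by
    have := mul_nonneg hρε (sub_nonneg.mpr hm)
    linarith
  obtain ⟨k, hk, hkH⟩ := hbook hH
  refine ⟨k, le_trans ?_ hk, hkH.trans (IsContained.of_le hHG)⟩
  rw [mul_assoc]
  refine mul_le_mul_of_nonneg_left ?_ (by positivity)
  rw [← Real.sqrt_mul hε0.le]
  refine Real.sqrt_le_iff.mpr ⟨H.adjSpectralRadius_nonneg, ?_⟩
  have h1 : ε * (1 * G.edgeSet.ncard) ≤ ε * (2 * (1 - ρ) * G.edgeSet.ncard) := by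
    gcongr; linarith
  have h2 : 0 ≤ (1 - ε) * ((1 - ρ) * H.edgeSet.ncard) :=
    mul_nonneg (by linarith) (mul_nonneg (by linarith) hm0)
  linarith

end SimpleGraph
end Books

/-! ### Graphs with few vertices -/

section Sharpness

open scoped Classical

/-- A graph on `n + 1` vertices containing a clique on `n` vertices has `λ ≥ n - 1`. -/
lemma SimpleGraph.sub_one_le_adjSpectralRadius {n : ℕ} (hn : 0 < n) (G : SimpleGraph (Fin (n + 1)))
    (h : ∀ i j : Fin n, i ≠ j → G.Adj i.castSucc j.castSucc) :
    (n : ℝ) - 1 ≤ G.adjSpectralRadius := by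
  have h1 := G.adjForm_le (fun i => if i = Fin.last n then 0 else 1)
  have h2 : ∑ i : Fin (n + 1), (if i = Fin.last n then (0 : ℝ) else 1) ^ 2 = n := by
    rw [Fin.sum_univ_castSucc]; simp [Fin.castSucc_ne_last]
  have h3 : G.adjForm (fun i => if i = Fin.last n then 0 else 1) = n * (n - 1) := by
    rw [adjForm, Fin.sum_univ_castSucc]
    have : ∀ i : Fin n, ∑ j : Fin (n + 1), G.adjInd i.castSucc j *
        ((if i.castSucc = Fin.last n then (0 : ℝ) else 1) * if j = Fin.last n then 0 else 1) =
        n - 1 := fun i => by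
      rw [Fin.sum_univ_castSucc]
      have h4 : ∀ j : Fin n, G.adjInd i.castSucc j.castSucc = 1 - if j = i then 1 else 0 :=
        fun j => by
          by_cases hij : j = i
          · simp [adjInd, hij]
          · simp [adjInd, hij, h i j (Ne.symm hij)]
      simp [Fin.castSucc_ne_last, h4]
    rw [Finset.sum_congr rfl fun i _ => this i]
    simp [mul_sub]
  rw [h2, h3, mul_comm] at h1
  exact le_of_mul_le_mul_right h1 (by exact_mod_cast hn)

/-- For `n.choose 2 ≤ m ≤ (n + 1).choose 2` there is a graph with `m` edges between the complete
graph on `n` vertices and the one on `n + 1` vertices. -/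
lemma SimpleGraph.exists_clique_ncard_edgeSet {n m : ℕ} (h1 : n.choose 2 ≤ m)
    (h2 : m ≤ (n + 1).choose 2) :
    ∃ G : SimpleGraph (Fin (n + 1)), G.edgeSet.ncard = m ∧
      ∀ i j : Fin n, i ≠ j → G.Adj i.castSucc j.castSucc := by
  set K : SimpleGraph (Fin (n + 1)) := (⊤ : SimpleGraph (Fin n)).map Fin.castSuccEmb with hK
  have hKc : K.edgeFinset.card = n.choose 2 := by
    have h := card_edgeFinset_map Fin.castSuccEmb (⊤ : SimpleGraph (Fin n))
    rw [card_edgeFinset_top_eq_card_choose_two, Fintype.card_fin] at h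
    rw [← h]
    congr!
  have hTc : (⊤ : SimpleGraph (Fin (n + 1))).edgeFinset.card = (n + 1).choose 2 := by
    rw [card_edgeFinset_top_eq_card_choose_two, Fintype.card_fin]
  obtain ⟨E, hKE, hET, hE⟩ := Finset.exists_subsuperset_card_eq
    (edgeFinset_mono (le_top : K ≤ ⊤)) (hKc.trans_le h1) (h2.trans_eq hTc.symm)
  have hes : (fromEdgeSet (E : Set (Sym2 (Fin (n + 1))))).edgeSet = E := by
    rw [edgeSet_fromEdgeSet, sdiff_eq_left, Set.disjoint_left]
    intro e he hd
    have := hET he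
    rw [mem_edgeFinset] at this
    exact not_isDiag_of_mem_edgeSet _ this hd
  refine ⟨fromEdgeSet E, by rw [hes, Set.ncard_coe_finset, hE], fun i j hij => ?_⟩
  rw [← mem_edgeSet, hes]
  refine hKE ?_
  rw [mem_edgeFinset, mem_edgeSet, hK, map_adj]
  exact ⟨i, j, hij, rfl, rfl⟩

/-- For large `m` there is a graph with `m` edges and only `O(√m)` vertices satisfying
`λ² > (1 - 1/r) 2m`. -/
theorem exists_lt_sq_of_generalizedBook_le (r : ℕ) (hr : 2 ≤ r) :
    ∃ C : ℝ, 0 < C ∧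
      ∀ᶠ m : ℕ in atTop, ∃ (n : ℕ) (G : SimpleGraph (Fin n)), G.edgeSet.ncard = m ∧
        (1 - 1 / (r : ℝ)) * (2 * (m : ℝ)) < G.adjSpectralRadius ^ 2 ∧
        ∀ k : ℕ, (generalizedBook r k).IsContained G → (k : ℝ) ≤ C * √(m : ℝ) := by
  refine ⟨3, by norm_num, ?_⟩
  filter_upwards [eventually_ge_atTop ((3 * r).choose 2)] with m hm
  -- The largest complete graph with at most `m` edges.
  set n := Nat.findGreatest (fun n => n.choose 2 ≤ m) (m + 2) with hn
  have hm1 : n.choose 2 ≤ m := Nat.findGreatest_spec (P := fun n => n.choose 2 ≤ m)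
    (Nat.zero_le _) (by simp)
  have hbd : ∀ q : ℕ, q.choose 2 ≤ m → q ≤ m + 1 := fun q hq => by
    by_contra hlt
    push Not at hlt
    have h1 : (m + 2).choose 2 ≤ q.choose 2 := Nat.choose_le_choose 2 (by omega)
    have h2 : (m + 2).choose 2 = (m + 1) + (m + 1).choose 2 := by
      rw [Nat.choose_succ_succ' (m + 1) 1, Nat.choose_one_right]
    omega
  have hnr : 3 * r ≤ n := Nat.le_findGreatest (by have := hbd _ hm; omega) hm
  have hm2 : m < (n + 1).choose 2 := by
    by_contra hlt
    push Not at hlt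
    have := hbd _ hlt
    have := Nat.le_findGreatest (P := fun n => n.choose 2 ≤ m) (n := m + 2) (by omega) hlt
    omega
  obtain ⟨G, hG, hcl⟩ := SimpleGraph.exists_clique_ncard_edgeSet hm1 hm2.le
  have hr2 : (2 : ℝ) ≤ r := by exact_mod_cast hr
  have hnr' : 3 * (r : ℝ) ≤ n := by exact_mod_cast hnr
  have hm1' : (n : ℝ) * (n - 1) / 2 ≤ m := by
    rw [← Nat.cast_choose_two]; exact_mod_cast hm1
  have hm2' : (m : ℝ) < (n + 1) * n / 2 := by
    have : (m : ℝ) < ((n + 1).choose 2 : ℕ) := by exact_mod_cast hm2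
    rw [Nat.cast_choose_two] at this
    push_cast at this
    linarith
  refine ⟨n + 1, G, hG, ?_, fun k hk => ?_⟩
  · have h1 := G.sub_one_le_adjSpectralRadius (by omega) hcl
    have h2 := pow_le_pow_left₀ (by linarith) h1 2
    refine lt_of_lt_of_le ?_ h2
    have h3 : 1 - 1 / (r : ℝ) = (r - 1) / r := by field_simp
    rw [h3, div_mul_eq_mul_div, div_lt_iff₀ (by linarith)]
    have h4 : ((r : ℝ) - 1) * (2 * m) ≤ (r - 1) * ((n + 1) * n) :=
      mul_le_mul_of_nonneg_left (by linarith) (by linarith)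
    have h5 : 0 ≤ (n : ℝ) * (n - 3 * r) := mul_nonneg (by linarith) (by linarith)
    linarith
  · obtain ⟨f⟩ := hk
    have h1 := Fintype.card_le_of_injective f f.injective
    simp only [Fintype.card_sum, Fintype.card_fin] at h1
    have h2 : (k : ℝ) ≤ n := by exact_mod_cast (by omega : k ≤ n)
    refine h2.trans ?_
    refine le_of_abs_le (abs_le_of_sq_le_sq ?_ (by positivity))
    rw [mul_pow, Real.sq_sqrt (Nat.cast_nonneg m)]
    have h3 : 0 ≤ (n : ℝ) * (n - 3 * r) := mul_nonneg (by linarith) (by linarith)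
    have h4 : 0 ≤ (n : ℝ) * (r - 2) := mul_nonneg (by linarith) (by linarith)
    have h5 : (0 : ℝ) ≤ n := by linarith
    linarith

end Sharpness

theorem mainTheorem3 (r : ℕ) (hr : 2 ≤ r) :
    -- a generalized book of size `Ω_r(√m)`
    (∃ c : ℝ, 0 < c ∧
      ∀ (V : Type u) [Fintype V] (G : SimpleGraph V) (m : ℕ), G.edgeSet.ncard = m →
        (1 - 1 / (r : ℝ)) * (2 * (m : ℝ)) < G.adjSpectralRadius ^ 2 →
        ∃ k : ℕ, c * √(m : ℝ) ≤ (k : ℝ) ∧ (generalizedBook r k).IsContained G) ∧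
    -- the order `√m` is best possible
    (∃ C : ℝ, 0 < C ∧
      ∀ᶠ m : ℕ in atTop, ∃ (n : ℕ) (G : SimpleGraph (Fin n)), G.edgeSet.ncard = m ∧
        (1 - 1 / (r : ℝ)) * (2 * (m : ℝ)) < G.adjSpectralRadius ^ 2 ∧
        ∀ k : ℕ, (generalizedBook r k).IsContained G → (k : ℝ) ≤ C * √(m : ℝ)) ∧
    -- the Li–Liu–Feng conjecture
    (∀ k : ℕ, 1 ≤ k → ∀ᶠ m : ℕ in atTop,
      ∀ (V : Type u) [Fintype V] (G : SimpleGraph V), G.edgeSet.ncard = m →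
        (generalizedBook r k).Free G →
        G.adjSpectralRadius ^ 2 ≤ (1 - 1 / (r : ℝ)) * (2 * (m : ℝ))) := by
  obtain ⟨c, hc, hbook⟩ := SimpleGraph.exists_generalizedBook_of_lt_sq.{u} hr
  refine ⟨⟨c, hc, ?_⟩, exists_lt_sq_of_generalizedBook_le r hr, fun k _ => ?_⟩
  · rintro V _ G m rfl h
    exact hbook V G h
  · have htend : Tendsto (fun m : ℕ => c * √(m : ℝ)) atTop atTop :=
      (Real.tendsto_sqrt_atTop.comp tendsto_natCast_atTop_atTop).const_mul_atTop hc
    filter_upwards [htend.eventually_ge_atTop (k : ℝ)] with m hm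
    rintro V _ G rfl hfree
    by_contra! hlt
    obtain ⟨l, hl, hlG⟩ := hbook V G hlt
    have hkl : k ≤ l := by exact_mod_cast hm.trans hl
    exact hfree ((SimpleGraph.generalizedBook_isContained_of_le hkl).trans hlG)
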